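/- **Setting.** Let $\rho_r,\rho_w\ge 0$ with $\rho_r+\rho_w<1$, $\beta\in(0,\tfrac12)$, $T\in\mathbb N$, $N=2^n$ and $\delta_N=2^{-N^\beta}$. Let $V_{1}$ and $V_{0}$ be the binary erasure channels with erasure probabilities $1$ and $0$. For $S\subseteq\{1,\dots,N\}$ let the *write block* of $S$ be the sequence of $N$ channels that has $V_1$ at the positions in $S$ and $V_0$ elsewhere, and let the *read block* of $S$ have $V_0$ at the positions in $S$ and $V_1$ elsewhere. The (non-stationary) polar transform is the recursion with $W^-(y^1,y^2|u^1)=\sum_{u^2}\frac12W^1(y^1|u^1\oplus u^2)W^2(y^2|u^2)$ and $W^+(y^1,y^2,u^1|u^2)=\frac12W^1(y^1|u^1\oplus u^2)W^2(y^2|u^2)$, in which the $(2i-1)$-th and $2i$-th channels generated from a block are the $-$ and $+$ combinations of the $i$-th channels generated from its first and its second half. Write $Z(W)=\sum_y\sqrt{W(y|0)W(y|1)}$. If $S$ is random, let $P^{(i)}_w$ (respectively $P^{(i)}_r$) be the probability that the $i$-th channel generated from the write (respectively read) block of $S$ has $Z=1$. Two laws of a random set of positions with fraction $\rho$ are considered: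 *fixed fraction*, uniform over all subsets with exactly $k_n$ elements, where $k_n$ is $\rho N$ rounded to an adjacent integer ($|k_n-\rho N|<1$); and *independent*, where each position is selected independently with probability $\rho$. **Scheme.** Given a design law for the write set (fraction $\rho_w$) and one for the read set (fraction $\rho_r$), put $\mathcal L_w=\{i:P^{(i)}_w\le\delta_N\}$, $\mathcal H_r=\{i:P^{(i)}_r\ge1-\delta_N\}$, and $$\mathcal I=\mathcal L_w\cap\mathcal H_r,\quad \mathcal R=\mathcal L_w\cap\mathcal H_r^c,\quad \mathcal F=\mathcal L_w^c\cap\mathcal H_r,\quad \mathcal B=\mathcal L_w^c\cap\mathcal H_r^c .$$ Choose $\mathcal E\subseteq\mathcal I$ with $|\mathcal E|=|\mathcal B|$ and a bijection $\mathcal B\to\mathcal E$. In block $t=1,\dots,T$ the vector $u^{1:N}$ carries message bits $M^t$ on $\mathcal I\setminus\mathcal E$, fresh independent uniform bits on $\mathcal E\cup\mathcal R$, publicly known fixed bits on $\mathcal F$, and on $\mathcal B$ pre-shared independent uniform bits if $t=1$ and the bits on $\mathcal E$ of block $t-1$ if $t\ge2$. The codeword is $x^{1:N}=u^{1:N}\mathbf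 G_N$ with $\mathbf G_N=\mathbf R\begin{bmatrix}1&0\\1&1\end{bmatrix}^{\otimes n}$ over $\mathbb F_2$, where $\mathbf R$ is the bit-reversal matrix. In block $t$ Eve chooses a random read set $S_t$, independently of everything transmitted, and obtains $Z^t$, which is $x^i$ at the positions $i\in S_t$ and the symbol $?$ elsewhere. Let $\mathrm L(T)=I(M^{1:T};Z^{1:T})$ be the total leakage for the realized read sets $S_1,\dots,S_T$; it is a function of these random sets. **Proposition 3.** As $N\to\infty$ with $T$ fixed, the scheme achieves strong security: $$\Pr\{\mathrm L(T)=0\}\longrightarrow 1,\qquad\text{and also}\qquad \mathbb E[\mathrm L(T)]\longrightarrow0 .$$ This holds in each of the following three cases: (a) the index sets are designed with the fixed-fraction laws and each $S_t$ has the fixed-fraction law; (b) the index sets are designed with the independent laws and each $S_t$ has the fixed-fraction law; (c) the index sets are designed with the independent laws and each $S_t$ has the independent law. The convergence is uniform in the choice of $\mathcal E$, of the bijection $\mathcal B\to\mathcal E$, of the frozen bits, of the distribution of the messages (assumed independent of the random bits), and of the dependence between the read sets of different blocks. -/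

import Mathlib

open scoped Kronecker

noncomputable section

namespace AWTC

/-! ### Binary-input discrete memoryless channels and their polarization -/

/-- A binary-input discrete memoryless channel with finite output alphabet `Out`;
`prob x y` is the transition probability `W(y | x)`. -/
structure BDMC where
  Out : Type
  [fintypeOut : Fintype Out]
  prob : ZMod 2 → Out → ℝ
  prob_nonneg : ∀ x y, 0 ≤ prob x y
  sum_prob : ∀ x, ∑ y, prob x y = 1

attribute [instance] BDMC.fintypeOut

/-- The Bhattacharyya parameter `Z(W) = ∑_y √(W(y|0) W(y|1))`. -/
def BDMC.Z (W : BDMC) : ℝ := ∑ y, Real.sqrt (W.prob 0 y * W.prob 1 y)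

theorem bec_sum (ε : ℝ) (x : ZMod 2) :
    ∑ y : Option (ZMod 2), (match y with
      | none => ε
      | some b => if b = x then 1 - ε else 0) = 1 := by
  rw [Fintype.sum_option]
  simp

/-- The binary erasure channel with erasure probability `ε`; `none` is the erasure symbol `?`. -/
def BEC (ε : ℝ) (h0 : 0 ≤ ε) (h1 : ε ≤ 1) : BDMC where
  Out := Option (ZMod 2)
  prob x y := match y with
    | none => ε
    | some b => if b = x then 1 - ε else 0
  prob_nonneg x y := by
    cases y with
    | none => exact h0
    | some b =>
      dsimp only
      split_ifs
      · linarith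
      · exact le_rfl
  sum_prob x := bec_sum ε x

/-- The full-noise erasure channel. -/
def fullNoise : BDMC := BEC 1 zero_le_one le_rfl

/-- The noiseless erasure channel. -/
def noiseless : BDMC := BEC 0 le_rfl zero_le_one

theorem sum_shift (f : ZMod 2 → ℝ) (a : ZMod 2) : ∑ u, f (u + a) = ∑ u, f u :=
  Equiv.sum_comp (Equiv.addRight a) f

/-- `W⁻(y₁, y₂ | u₁) = ∑_{u₂} ½ W₁(y₁ | u₁ ⊕ u₂) W₂(y₂ | u₂)`. -/
def minus (W₁ W₂ : BDMC) : BDMC where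
  Out := W₁.Out × W₂.Out
  prob u₁ y := ∑ u₂ : ZMod 2, 1 / 2 * W₁.prob (u₁ + u₂) y.1 * W₂.prob u₂ y.2
  prob_nonneg u₁ y := Finset.sum_nonneg fun u₂ _ =>
    mul_nonneg (mul_nonneg (by norm_num) (W₁.prob_nonneg _ _)) (W₂.prob_nonneg _ _)
  sum_prob u₁ := by
    rw [Finset.sum_comm]
    have h : ∀ u₂ : ZMod 2, ∑ y : W₁.Out × W₂.Out,
        1 / 2 * W₁.prob (u₁ + u₂) y.1 * W₂.prob u₂ y.2 = 1 / 2 := by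
      intro u₂
      rw [Fintype.sum_prod_type]
      simp only [← Finset.mul_sum, W₂.sum_prob, mul_one, W₁.sum_prob]
    simp only [h, Finset.sum_const, Finset.card_univ, ZMod.card, nsmul_eq_mul]
    norm_num

/-- `W⁺(y₁, y₂, u₁ | u₂) = ½ W₁(y₁ | u₁ ⊕ u₂) W₂(y₂ | u₂)`. -/
def plus (W₁ W₂ : BDMC) : BDMC where
  Out := W₁.Out × W₂.Out × ZMod 2
  prob u₂ y := 1 / 2 * W₁.prob (y.2.2 + u₂) y.1 * W₂.prob u₂ y.2.1
  prob_nonneg u₂ y :=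
    mul_nonneg (mul_nonneg (by norm_num) (W₁.prob_nonneg _ _)) (W₂.prob_nonneg _ _)
  sum_prob u₂ := by
    rw [Fintype.sum_prod_type, Finset.sum_congr rfl fun y₁ _ => Fintype.sum_prod_type _,
      Finset.sum_congr rfl fun y₁ _ => Finset.sum_comm, Finset.sum_comm]
    have h : ∀ u₁ : ZMod 2, ∑ y₁ : W₁.Out, ∑ y₂ : W₂.Out,
        1 / 2 * W₁.prob (u₁ + u₂) y₁ * W₂.prob u₂ y₂ = 1 / 2 := by
      intro u₁
      simp only [← Finset.mul_sum, W₂.sum_prob, mul_one, W₁.sum_prob]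
    simp only [h, Finset.sum_const, Finset.card_univ, ZMod.card, nsmul_eq_mul]
    norm_num

/-- The channels generated from a block of `N = 2 ^ n` channels, indices counted from `0`. The
channels `2 i` and `2 i + 1` of the block are the `minus` and the `plus` combination of the `i`-th
channels generated from the first half and from the second half of the block. -/
def polarize : (n : ℕ) → (Fin (2 ^ n) → BDMC) → Fin (2 ^ n) → BDMC
  | 0, W, i => W i
  | n + 1, W, i =>
    let j : Fin (2 ^ n) := ⟨i.val / 2, by have h := pow_succ 2 n; have := i.isLt; omega⟩
    let A := polarize n
      (fun k => W ⟨k.val, by have h := pow_succ 2 n; have := k.isLt; omega⟩) j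
    let B := polarize n
      (fun k => W ⟨2 ^ n + k.val, by have h := pow_succ 2 n; have := k.isLt; omega⟩) j
    if i.val % 2 = 0 then minus A B else plus A B

/-! ### The polar transform `G_N = R F^{⊗ n}` -/

/-- The polarization kernel. -/
def kernelF : Matrix (Fin 2) (Fin 2) (ZMod 2) := !![1, 0; 1, 1]

/-- The Kronecker power `F^{⊗ n}`. -/
def kronPow : (n : ℕ) → Matrix (Fin (2 ^ n)) (Fin (2 ^ n)) (ZMod 2)
  | 0 => 1
  | n + 1 =>
    let e : Fin 2 × Fin (2 ^ n) ≃ Fin (2 ^ (n + 1)) :=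
      finProdFinEquiv.trans (finCongr (pow_succ' 2 n).symm)
    Matrix.reindex e e (kernelF ⊗ₖ kronPow n)

/-- Reversal of the `n` binary digits of an index. -/
def bitReverse (n : ℕ) (i : Fin (2 ^ n)) : Fin (2 ^ n) := (BitVec.ofFin i).reverse.toFin

/-- The bit-reversal permutation matrix. -/
def bitReverseMatrix (n : ℕ) : Matrix (Fin (2 ^ n)) (Fin (2 ^ n)) (ZMod 2) :=
  Matrix.of fun i j => if j = bitReverse n i then 1 else 0

/-- The generator matrix of polar codes of length `2 ^ n`. -/
def G (n : ℕ) : Matrix (Fin (2 ^ n)) (Fin (2 ^ n)) (ZMod 2) := bitReverseMatrix n * kronPow n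

/-! ### Adversarial reading and writing -/

/-- The channel block from Alice to Bob when the positions in `S` are overwritten. -/
def writeBlock {n : ℕ} (S : Finset (Fin (2 ^ n))) (i : Fin (2 ^ n)) : BDMC :=
  if i ∈ S then fullNoise else noiseless

/-- The channel block from Alice to Eve when the positions in `S` are read. -/
def readBlock {n : ℕ} (S : Finset (Fin (2 ^ n))) (i : Fin (2 ^ n)) : BDMC :=
  if i ∈ S then noiseless else fullNoise

/-- What Eve obtains from the codeword `x` by reading the positions in `S`. -/
def observe {n : ℕ} (S : Finset (Fin (2 ^ n))) (x : Fin (2 ^ n) → ZMod 2) :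
    Fin (2 ^ n) → Option (ZMod 2) :=
  fun i => if i ∈ S then some (x i) else none

/-- Probability mass function of a set of positions that is uniformly distributed over all sets of
exactly `k` positions out of `2 ^ n` (used for `k ≤ 2 ^ n`). -/
def fixedLaw (n k : ℕ) (S : Finset (Fin (2 ^ n))) : ℝ :=
  if S.card = k then 1 / ((2 ^ n).choose k : ℝ) else 0

/-- Probability mass function of a set that contains each of the `2 ^ n` positions with
probability `p`, independently of the others (used for `0 ≤ p ≤ 1`). -/
def indepLaw (n : ℕ) (p : ℝ) (S : Finset (Fin (2 ^ n))) : ℝ :=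
  p ^ S.card * (1 - p) ^ (2 ^ n - S.card)

/-- `P = Pr {Z = 1}` for the `i`-th channel generated from the channel block `block S`, where `S` is
a random set of positions with probability mass function `law`. -/
def probZOne {n : ℕ} (law : Finset (Fin (2 ^ n)) → ℝ)
    (block : Finset (Fin (2 ^ n)) → Fin (2 ^ n) → BDMC) (i : Fin (2 ^ n)) : ℝ :=
  ∑ S : Finset (Fin (2 ^ n)), if (polarize n (block S) i).Z = 1 then law S else 0

/-! ### The index sets -/

/-- The threshold `δ_N = 2 ^ (- N ^ β)` with `N = 2 ^ n`. -/
def delta (β : ℝ) (n : ℕ) : ℝ := (2 : ℝ) ^ (-(((2 : ℝ) ^ n) ^ β))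

section IndexSets

variable {n : ℕ} (β : ℝ) (lawW lawR : Finset (Fin (2 ^ n)) → ℝ)

/-- Channels that are noiseless for Bob with probability almost one. -/
def setLw : Finset (Fin (2 ^ n)) :=
  Finset.univ.filter fun i => probZOne lawW writeBlock i ≤ delta β n

/-- Channels that are full-noise for Eve with probability almost one. -/
def setHr : Finset (Fin (2 ^ n)) :=
  Finset.univ.filter fun i => 1 - delta β n ≤ probZOne lawR readBlock i

def setI : Finset (Fin (2 ^ n)) := setLw β lawW ∩ setHr β lawR

def setR : Finset (Fin (2 ^ n)) := setLw β lawW ∩ (setHr β lawR)ᶜ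

def setF : Finset (Fin (2 ^ n)) := (setLw β lawW)ᶜ ∩ setHr β lawR

def setB : Finset (Fin (2 ^ n)) := (setLw β lawW)ᶜ ∩ (setHr β lawR)ᶜ

end IndexSets

/-! ### The multi-block chaining scheme -/

/-- Bits placed on a set of positions in each of `T` blocks. -/
abbrev BlockBits {n : ℕ} (T : ℕ) (A : Finset (Fin (2 ^ n))) : Type := Fin T → A → ZMod 2

/-- The input `u` of the polar transform in block `t`, for index sets `I`, `R`, `F`, `B` that
partition the positions, `E ⊆ I`, and a matching `σ` of `B` with `E`: message bits `m` on `I \ E`,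
random bits `r` on `E ∪ R`, frozen bits `f` on `F`; on `B` the pre-shared bits `b` in the first
block, and the bits on `E` of the previous block in the later blocks. -/
def inputBits {n T : ℕ} {I R F B E : Finset (Fin (2 ^ n))} (σ : B ≃ E)
    (f : BlockBits T F) (m : BlockBits T (I \ E)) (r : BlockBits T (E ∪ R)) (b : B → ZMod 2)
    (t : Fin T) (i : Fin (2 ^ n)) : ZMod 2 :=
  if hM : i ∈ I \ E then m t ⟨i, hM⟩
  else if hR : i ∈ E ∪ R then r t ⟨i, hR⟩
  else if hF : i ∈ F then f t ⟨i, hF⟩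
  else if hB : i ∈ B then
    if t.val = 0 then b ⟨i, hB⟩
    else r ⟨t.val - 1, by have := t.isLt; omega⟩
      ⟨σ ⟨i, hB⟩, Finset.mem_union_left _ (σ ⟨i, hB⟩).2⟩
  else 0

/-- The joint distribution of the messages `M^{1:T}` and of Eve's observations `Z^{1:T}` when Eve
reads the positions `S t` of the codeword `x = u G_N` of block `t`: the messages have distribution
`pM`; the random bits on `E ∪ R` and the pre-shared bits are uniform and independent of them. -/
def jointLaw {n T : ℕ} {I R F B E : Finset (Fin (2 ^ n))} (σ : B ≃ E)
    (f : BlockBits T F) (pM : PMF (BlockBits T (I \ E))) (S : Fin T → Finset (Fin (2 ^ n))) :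
    PMF (BlockBits T (I \ E) × (Fin T → Fin (2 ^ n) → Option (ZMod 2))) :=
  pM.bind fun m =>
    (PMF.uniformOfFintype (BlockBits T (E ∪ R) × (B → ZMod 2))).map fun rb =>
      (m, fun t => observe (S t)
        (Matrix.vecMul (inputBits (I := I) σ f m rb.1 rb.2 t) (G n)))

/-- Mutual information, in bits, of the two components of a finite pair with distribution `q`.
Terms with `q (a, c) = 0` vanish. -/
def mutualInfo {α γ : Type} [Fintype α] [Fintype γ] (q : PMF (α × γ)) : ℝ :=
  ∑ a : α, ∑ c : γ, (q (a, c)).toReal *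
    Real.logb 2 ((q (a, c)).toReal /
      (((q.map Prod.fst) a).toReal * ((q.map Prod.snd) c).toReal))

/-- The total leakage `L(T) = I(M^{1:T}; Z^{1:T})` when Eve reads the positions `S t` in block
`t`. -/
def leakage {n T : ℕ} {I R F B E : Finset (Fin (2 ^ n))} (σ : B ≃ E)
    (f : BlockBits T F) (pM : PMF (BlockBits T (I \ E)))
    (S : Fin T → Finset (Fin (2 ^ n))) : ℝ :=
  mutualInfo (jointLaw (I := I) (R := R) σ f pM S)

/-- Strong security as `N = 2 ^ n → ∞` of the scheme with `T` blocks whose index sets are designed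
for write and read sets with laws `designW`, `designR`, against an adversary whose read set has law
`attack` in every block: uniformly in all remaining choices (the chaining set `E` and its matching
with `B`, the frozen bits, the message distribution, and the dependence `μ` between the read sets
of different blocks), the probability that the leakage is exactly `0` tends to `1`, and the expected
leakage tends to `0`. -/
def StronglySecure (β : ℝ) (T : ℕ)
    (designW designR attack : (n : ℕ) → Finset (Fin (2 ^ n)) → ℝ) : Prop :=
  ∀ ε : ℝ, 0 < ε → ∃ n₀ : ℕ, ∀ n : ℕ, n₀ ≤ n →
    ∀ E : Finset (Fin (2 ^ n)), E ⊆ setI β (designW n) (designR n) →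
    ∀ (σ : (setB β (designW n) (designR n)) ≃ E)
      (f : BlockBits T (setF β (designW n) (designR n)))
      (pM : PMF (BlockBits T (setI β (designW n) (designR n) \ E)))
      (μ : PMF (Fin T → Finset (Fin (2 ^ n)))),
      (∀ t A, ((μ.map fun S => S t) A).toReal = attack n A) →
      1 - ε ≤ (μ.toOuterMeasure {S | leakage (R := setR β (designW n) (designR n))
          σ f pM S = 0}).toReal ∧
        ∑ S, (μ S).toReal * leakage (R := setR β (designW n) (designR n)) σ f pM S ≤ ε

end AWTC

end

/-! Fix the read sets. Inputs whose codeword vanishes on `S` form a subspace, `invisible S`; adding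
such a vector to the input changes nothing that Eve sees. If the generated channel `i` has `Z = 1`,
bit `i` is not determined by the earlier bits and the code bits read, so this subspace contains a
vector with leading entry 1 at `i` (`exists_leading_vector`). When this holds for every `i` in `H_r
= I ∪ F`, elimination yields invisible vectors with arbitrary values on `I ∪ F`
(`exists_mem_eqOn_of_leading`). Any change of the messages is then compensated by a shift of the
random bits on `E ∪ R` and of the pre-shared bits, with the frozen bits untouched; the chaining
constraint is met by choosing the vectors from the last block backwards (`exists_shift`). Eve's view
has the same law for all messages, and the leakage is exactly 0 (`leakage_eq_zero`).

For random read sets, each `i ∈ H_r` violates `Z = 1` with design probability at most `δ_N`. The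
attack law is at most `κ` times the design law with `κ` polynomial in `N`; in the mixed case this
holds because the independent law has the prescribed size with probability at least of order `N⁻²`
(`fixedLaw_le_indepLaw`). A union bound over `T N` events, together with leakage at most `T N` bits,
gives both limits, since `δ_N` beats every power of `N`. -/

namespace AWTC

/-! ### Perfect channels under the two polar combinations -/

/-- No output symbol is compatible with both inputs. -/
def BDMC.Perfect (W : BDMC) : Prop := ∀ y, W.prob 0 y * W.prob 1 y = 0

theorem BDMC.Perfect.Z_eq_zero {W : BDMC} (h : W.Perfect) : W.Z = 0 := by
  simp [BDMC.Z, h _]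

theorem minus_perfect {A B : BDMC} (hA : A.Perfect) (hB : B.Perfect) : (minus A B).Perfect := by
  intro y
  have h1 := hA y.1
  have h2 := hB y.2
  have e : (1 + 1 : ZMod 2) = 0 := rfl
  simp only [minus, show ∀ f : ZMod 2 → ℝ, ∑ u, f u = f 0 + f 1 from
    fun f => Fin.sum_univ_two f, zero_add, add_zero, e]
  rcases mul_eq_zero.1 h1 with h | h <;> rcases mul_eq_zero.1 h2 with h' | h' <;> simp [h, h']

/-- The output of the plus channel includes `u₁`, so one readable copy is enough to recover `u₂`. -/
theorem plus_perfect_left {A B : BDMC} (hA : A.Perfect) : (plus A B).Perfect := by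
  rintro ⟨y₁, y₂, u⟩
  have h1 := hA y₁
  have e : (1 + 1 : ZMod 2) = 0 := rfl
  have hu : u = 0 ∨ u = 1 := by revert u; decide
  rcases hu with rfl | rfl <;> rcases mul_eq_zero.1 h1 with h | h <;> simp [plus, h, e]

theorem plus_perfect_right {A B : BDMC} (hB : B.Perfect) : (plus A B).Perfect := by
  rintro ⟨y₁, y₂, u⟩
  rcases mul_eq_zero.1 (hB y₂) with h | h <;> simp [plus, h]

theorem noiseless_perfect : noiseless.Perfect := by
  intro y
  cases y with
  | none => simp [noiseless, BEC]
  | some b =>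
    have hb : b = 0 ∨ b = 1 := by revert b; decide
    rcases hb with rfl | rfl <;> simp [noiseless, BEC]

/-! ### Recursive structure of the polar transform -/

/-- Positions of a block, as a half of the block and a position in that half. -/
def halfEquiv (n : ℕ) : Fin 2 × Fin (2 ^ n) ≃ Fin (2 ^ (n + 1)) :=
  finProdFinEquiv.trans (finCongr (pow_succ' 2 n).symm)

/-- Positions of a block, as a pair of neighbours and a member of that pair. -/
def pairEquiv (n : ℕ) : Fin (2 ^ n) × Fin 2 ≃ Fin (2 ^ (n + 1)) :=
  finProdFinEquiv.trans (finCongr (pow_succ 2 n).symm)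

theorem halfEquiv_val (n : ℕ) (a : Fin 2) (b : Fin (2 ^ n)) :
    (halfEquiv n (a, b)).val = b.val + 2 ^ n * a.val := rfl

theorem pairEquiv_val (n : ℕ) (a : Fin (2 ^ n)) (b : Fin 2) :
    (pairEquiv n (a, b)).val = b.val + 2 * a.val := rfl

theorem kronPow_halfEquiv (n : ℕ) (a c : Fin 2) (b d : Fin (2 ^ n)) :
    kronPow (n + 1) (halfEquiv n (a, b)) (halfEquiv n (c, d)) = kernelF a c * kronPow n b d := by
  change (Matrix.reindex (halfEquiv n) (halfEquiv n) (kernelF ⊗ₖ kronPow n)) _ _ = _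
  simp [Matrix.kroneckerMap_apply]

theorem testBit_bitReverse (n : ℕ) (i : Fin (2 ^ n)) (k : ℕ) :
    (bitReverse n i).val.testBit k = (decide (k < n) && i.val.testBit (n - 1 - k)) := by
  have h := BitVec.getLsbD_reverse (x := BitVec.ofFin i) (i := k)
  have h1 : (bitReverse n i).val.testBit k = (BitVec.ofFin i).reverse.getLsbD k := rfl
  rw [h1, h, BitVec.getMsbD_eq_getLsbD]
  rfl

/-- Reversal sends the last digit, which selects the member of a pair, to the leading digit, which
selects the half. This is what aligns the recursion of `G` with that of `polarize`. -/
theorem bitReverse_pairEquiv (n : ℕ) (j : Fin (2 ^ n)) (b : Fin 2) :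
    bitReverse (n + 1) (pairEquiv n (j, b)) = halfEquiv n (b, bitReverse n j) := by
  apply Fin.ext
  apply Nat.eq_of_testBit_eq
  intro k
  rw [testBit_bitReverse, halfEquiv_val, pairEquiv_val, add_comm _ (2 ^ n * b.val),
    Nat.testBit_two_pow_mul_add _ (bitReverse n j).isLt, testBit_bitReverse]
  rcases lt_trichotomy k n with h | rfl | h
  · have : n + 1 - 1 - k = (n - 1 - k) + 1 := by omega
    rw [this, Nat.testBit_succ, if_pos h]
    have : (b.val + 2 * j.val) / 2 = j.val := by have := b.isLt; omega
    simp [this, h, h.le]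
  · have := b.isLt
    fin_cases b <;> simp
  · have h2 : ¬ k < n + 1 := by omega
    have h3 : b.val.testBit (k - n) = false := by
      apply Nat.testBit_lt_two_pow
      calc b.val < 2 := b.isLt
        _ = 2 ^ 1 := rfl
        _ ≤ 2 ^ (k - n) := Nat.pow_le_pow_right (by norm_num) (by omega)
    simp [h2, h3, h.not_gt]

theorem G_apply (n : ℕ) (i j : Fin (2 ^ n)) : G n i j = kronPow n (bitReverse n i) j := by
  simp [G, bitReverseMatrix, Matrix.mul_apply]

theorem vecMul_G_succ (n : ℕ) (u : Fin (2 ^ (n + 1)) → ZMod 2) (a : Fin 2) (k : Fin (2 ^ n)) :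
    Matrix.vecMul u (G (n + 1)) (halfEquiv n (a, k)) =
      Matrix.vecMul (fun j => kernelF 0 a * u (pairEquiv n (j, 0)) + u (pairEquiv n (j, 1)))
        (G n) k := by
  simp only [Matrix.vecMul, dotProduct]
  rw [← (pairEquiv n).sum_comp, Fintype.sum_prod_type]
  refine Finset.sum_congr rfl fun j _ => ?_
  have h1 : kernelF 1 a = 1 := by fin_cases a <;> rfl
  simp only [Fin.sum_univ_two, G_apply, bitReverse_pairEquiv, kronPow_halfEquiv, h1]
  ring

/-- If the `i`-th generated channel is not perfect, then the bit `i` is not determined by the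
previous bits and by the code bits sent over the perfect channels. -/
theorem exists_leading_vector : ∀ (n : ℕ) (W : Fin (2 ^ n) → BDMC) (i : Fin (2 ^ n)),
    ¬ (polarize n W i).Perfect → ∃ v : Fin (2 ^ n) → ZMod 2, (∀ j < i, v j = 0) ∧ v i = 1 ∧
      ∀ k, (W k).Perfect → Matrix.vecMul v (G n) k = 0
  | 0, W, i, h => by
    have hs : Subsingleton (Fin (2 ^ 0)) := by simpa using Fin.subsingleton_one
    refine ⟨fun _ => 1, fun j hj => absurd hj ?_, rfl, fun k hk => absurd hk ?_⟩
    · rw [hs.elim j i]; exact lt_irrefl _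
    · rw [hs.elim k i]; exact h
  | n + 1, W, i, h => by
    obtain ⟨⟨j, b⟩, rfl⟩ := (pairEquiv n).surjective i
    have hj : (⟨(pairEquiv n (j, b)).val / 2, by
        have h := pow_succ 2 n; have := (pairEquiv n (j, b)).isLt; omega⟩ : Fin (2 ^ n)) = j := by
      apply Fin.ext
      have := pairEquiv_val n j b
      have := b.isLt
      simp only
      omega
    set A := polarize n (fun k => W (halfEquiv n (0, k))) j with hAdef
    set B := polarize n (fun k => W (halfEquiv n (1, k))) j with hBdef
    have hpol : polarize (n + 1) W (pairEquiv n (j, b)) =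
        if b = 0 then minus A B else plus A B := by
      rw [polarize]
      simp only [hj]
      have e0 : (fun k : Fin (2 ^ n) => W ⟨k.val, by
          have h := pow_succ 2 n; have := k.isLt; omega⟩) =
          fun k => W (halfEquiv n (0, k)) := by
        funext k; congr 1
      have e1 : (fun k : Fin (2 ^ n) => W ⟨2 ^ n + k.val, by
          have h := pow_succ 2 n; have := k.isLt; omega⟩) =
          fun k => W (halfEquiv n (1, k)) := by
        funext k; congr 1; apply Fin.ext; simp [halfEquiv_val, add_comm]
      rw [e0, e1]
      have : ((pairEquiv n (j, b)).val % 2 = 0) ↔ b = 0 := by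
        rw [pairEquiv_val, Fin.ext_iff]; have := b.isLt; simp; omega
      simp only [this, hAdef, hBdef]
    rw [hpol] at h
    -- combine vectors for the even and for the odd positions
    have key : ∀ p q : Fin (2 ^ n) → ZMod 2, (∀ l < j, p l = 0) → (∀ l < j, q l = 0) →
        (b = 0 → p j = 1) → (b = 1 → p j = 0 ∧ q j = 1) →
        (∀ k, (W (halfEquiv n (0, k))).Perfect → Matrix.vecMul (p + q) (G n) k = 0) →
        (∀ k, (W (halfEquiv n (1, k))).Perfect → Matrix.vecMul q (G n) k = 0) →
        ∃ v : Fin (2 ^ (n + 1)) → ZMod 2, (∀ l < pairEquiv n (j, b), v l = 0) ∧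
          v (pairEquiv n (j, b)) = 1 ∧
          ∀ k, (W k).Perfect → Matrix.vecMul v (G (n + 1)) k = 0 := by
      intro p q hp hq hb0 hb1 h0 h1
      let v : Fin (2 ^ (n + 1)) → ZMod 2 := fun l =>
        let c := (pairEquiv n).symm l
        if c.2 = 0 then p c.1 else q c.1
      have v0 : ∀ l, v (pairEquiv n (l, 0)) = p l := fun l => by simp [v]
      have v1 : ∀ l, v (pairEquiv n (l, 1)) = q l := fun l => by simp [v]
      refine ⟨v, ?_, ?_, ?_⟩
      · intro l hl
        obtain ⟨⟨l, c⟩, rfl⟩ := (pairEquiv n).surjective l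
        rw [Fin.lt_def, pairEquiv_val, pairEquiv_val] at hl
        have hlt := b.isLt
        have hlt' := c.isLt
        by_cases hlj : l < j
        · fin_cases c
          · exact (v0 l).trans (hp l hlj)
          · exact (v1 l).trans (hq l hlj)
        · have : l = j := by
            apply Fin.ext; have := Fin.le_def.1 (not_lt.1 hlj); omega
          subst this
          have hb : b = 1 := by apply Fin.ext; simp; omega
          have hc : c = 0 := by apply Fin.ext; simp; omega
          subst hc
          exact (v0 l).trans (hb1 hb).1
      · fin_cases b
        · exact (v0 j).trans (hb0 rfl)
        · exact (v1 j).trans (hb1 rfl).2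
      · intro k hk
        obtain ⟨⟨a, k⟩, rfl⟩ := (halfEquiv n).surjective k
        rw [vecMul_G_succ]
        simp only [v0, v1]
        fin_cases a
        · have := h0 k hk
          simpa [kernelF, Pi.add_def] using this
        · have := h1 k hk
          simpa [kernelF] using this
    by_cases hb : b = 0
    · rw [if_pos hb] at h
      have hb1 : b ≠ 1 := by rw [hb]; decide
      -- Minus case: only the even part `p` needs a leading 1 at `j`. With `A` perfect, the choice
      -- `p = q` makes the first half of the codeword vanish; otherwise `q = 0` makes the second
      -- half vanish.
      by_cases hpA : A.Perfect
      · have hpB : ¬ B.Perfect := fun hpB => h (minus_perfect hpA hpB)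
        obtain ⟨w, hw0, hw1, hw⟩ := exists_leading_vector n _ j hpB
        have hww : w + w = 0 := by funext l; exact CharTwo.add_self_eq_zero (w l)
        refine key w w hw0 hw0 (fun _ => hw1) (fun e => absurd e hb1) ?_ hw
        intro k _
        rw [hww, Matrix.zero_vecMul]; rfl
      · obtain ⟨w, hw0, hw1, hw⟩ := exists_leading_vector n _ j hpA
        refine key w 0 hw0 (fun _ _ => rfl) (fun _ => hw1) (fun e => absurd e hb1) ?_ ?_
        · simpa using hw
        · intro k _
          rw [Matrix.zero_vecMul]; rfl
    · rw [if_neg hb] at h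
      -- Plus case: neither factor is perfect. The halves of the codeword come from `w` and `w'`,
      -- and the entry of `p = w + w'` at `j` cancels, so the leading position is odd.
      obtain ⟨w, hw0, hw1, hw⟩ := exists_leading_vector n _ j fun hp => h (plus_perfect_left hp)
      obtain ⟨w', hw0', hw1', hw'⟩ :=
        exists_leading_vector n _ j fun hp => h (plus_perfect_right hp)
      refine key (w + w') w' (fun l hl => by simp [hw0 l hl, hw0' l hl]) hw0'
        (fun e => absurd e hb) (fun _ => ⟨?_, hw1'⟩) ?_ hw'
      · rw [Pi.add_apply, hw1, hw1']; rfl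
      · have : w + w' + w' = w := by
          funext l; simp [add_assoc, CharTwo.add_self_eq_zero]
        rw [this]; exact hw

/-- Only `Z ≠ 0` matters, so the dichotomy `Z ∈ {0, 1}` for these channels is not needed. -/
theorem exists_leading_vector_of_Z_eq_one {n : ℕ} {S : Finset (Fin (2 ^ n))} {i : Fin (2 ^ n)}
    (h : (polarize n (readBlock S) i).Z = 1) :
    ∃ v : Fin (2 ^ n) → ZMod 2, (∀ j < i, v j = 0) ∧ v i = 1 ∧
      ∀ k ∈ S, Matrix.vecMul v (G n) k = 0 := by
  obtain ⟨v, h0, h1, hv⟩ := exists_leading_vector n (readBlock S) i fun hp => by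
    rw [hp.Z_eq_zero] at h; exact zero_ne_one h
  refine ⟨v, h0, h1, fun k hk => hv k ?_⟩
  rw [readBlock, if_pos hk]
  exact noiseless_perfect

/-! ### Invisible input shifts -/

/-- A subspace that has a vector with leading position `i` for each `i ∈ H` projects onto the
coordinates in `H`. -/
theorem exists_mem_eqOn_of_leading {ι k : Type*} [LinearOrder ι] [Field k]
    (K : Submodule k (ι → k)) (H : Finset ι)
    (hK : ∀ i ∈ H, ∃ v ∈ K, (∀ j < i, v j = 0) ∧ v i = 1) (a : ι → k) :
    ∃ w ∈ K, ∀ i ∈ H, w i = a i := by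
  -- Corrections are made in increasing order of position: a vector with leading position `i` leaves
  -- the smaller, already fixed coordinates alone.
  induction H using Finset.induction_on_max with
  | empty => exact ⟨0, K.zero_mem, by simp⟩
  | insert i H hi ih =>
    obtain ⟨w, hw, hwa⟩ := ih fun j hj => hK j (Finset.mem_insert_of_mem hj)
    obtain ⟨v, hv, hv0, hv1⟩ := hK i (Finset.mem_insert_self _ _)
    refine ⟨w + (a i - w i) • v, K.add_mem hw (K.smul_mem _ hv), fun j hj => ?_⟩
    rcases Finset.mem_insert.1 hj with rfl | hj
    · simp [hv1]
    · simp [hv0 j (hi j hj), hwa j hj]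

/-- Vectors whose encoding vanishes on `S`. -/
def invisible {n : ℕ} (S : Finset (Fin (2 ^ n))) : Submodule (ZMod 2) (Fin (2 ^ n) → ZMod 2) where
  carrier := {v | ∀ k ∈ S, Matrix.vecMul v (G n) k = 0}
  zero_mem' k _ := by rw [Matrix.zero_vecMul]; rfl
  add_mem' {v w} hv hw k hk := by
    rw [Matrix.add_vecMul, Pi.add_apply, hv k hk, hw k hk, add_zero]
  smul_mem' c v hv k hk := by
    rw [Matrix.smul_vecMul, Pi.smul_apply, hv k hk, smul_zero]

theorem observe_add_invisible {n : ℕ} {S : Finset (Fin (2 ^ n))} {w : Fin (2 ^ n) → ZMod 2}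
    (hw : w ∈ invisible S) (u : Fin (2 ^ n) → ZMod 2) :
    observe S (Matrix.vecMul (u + w) (G n)) = observe S (Matrix.vecMul u (G n)) := by
  funext k
  by_cases hk : k ∈ S
  · simp [observe, hk, Matrix.add_vecMul, hw k hk]
  · simp [observe, hk]

/-- The shift on `E` in block `t` must match the shift on `B` in block `t + 1`, so shifts are
determined from the last block down. -/
theorem exists_backward_recursion {V : Type*} (step : ℕ → V → V) (T : ℕ) (v : V) :
    ∃ w : ℕ → V, ∀ t < T, w t = step t (w (t + 1)) := by
  -- The end value must vary, since the induction step replaces `v` by `step T v`.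
  suffices ∀ v, ∃ w : ℕ → V, w T = v ∧ ∀ t < T, w t = step t (w (t + 1)) by
    obtain ⟨w, -, hw⟩ := this v
    exact ⟨w, hw⟩
  induction T with
  | zero => exact fun v => ⟨fun _ => v, rfl, by simp⟩
  | succ T ih =>
    intro v
    obtain ⟨w, hT, hw⟩ := ih (step T v)
    refine ⟨Function.update w (T + 1) v, by simp, fun t ht => ?_⟩
    rcases Nat.lt_succ_iff_lt_or_eq.1 ht with h | rfl
    · rw [Function.update_of_ne (by omega), Function.update_of_ne (by omega), hw t h]
    · rw [Function.update_of_ne (by omega), Function.update_self, hT]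

end AWTC

namespace AWTC

/-! ### Zero leakage for good read sets -/

section Chaining

variable {n T : ℕ} {I R F B E : Finset (Fin (2 ^ n))}

/-- Changing the messages can be compensated, in what Eve sees, by a shift of the random bits. -/
theorem exists_shift (σ : B ≃ E) (H : Finset (Fin (2 ^ n))) (hEI : E ⊆ I) (hIH : I ⊆ H)
    (hFH : F ⊆ H) (hcover : ∀ i, i ∈ I ∨ i ∈ R ∨ i ∈ F ∨ i ∈ B)
    (f : BlockBits T F) (S : Fin T → Finset (Fin (2 ^ n)))
    (hS : ∀ t, ∀ i ∈ H, ∃ v ∈ invisible (S t), (∀ j < i, v j = 0) ∧ v i = 1)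
    (m m' : BlockBits T (I \ E)) :
    ∃ (dr : BlockBits T (E ∪ R)) (db : B → ZMod 2), ∀ r b t,
      observe (S t) (Matrix.vecMul (inputBits (I := I) σ f m' (r + dr) (b + db) t) (G n)) =
        observe (S t) (Matrix.vecMul (inputBits (I := I) σ f m r b t) (G n)) := by
  choose c hcK hc using fun t a => exists_mem_eqOn_of_leading (invisible (S t)) H (hS t) a
  -- Prescribed shift: the message difference on `I \ E`, the shift of the next block at the matched
  -- position on `E`, and 0 on `F`. For the last block `next` is arbitrary, as no later block reuses
  -- its bits on `E`.
  let target : Fin T → (Fin (2 ^ n) → ZMod 2) → Fin (2 ^ n) → ZMod 2 := fun t next i =>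
    if hM : i ∈ I \ E then m' t ⟨i, hM⟩ - m t ⟨i, hM⟩
    else if hE : i ∈ E then next (σ.symm ⟨i, hE⟩) else 0
  obtain ⟨w, hw⟩ := exists_backward_recursion
    (fun t next => if h : t < T then c ⟨t, h⟩ (target ⟨t, h⟩ next) else 0) T 0
  have hwK : ∀ t : Fin T, w t ∈ invisible (S t) := fun t => by
    rw [hw t t.isLt, dif_pos t.isLt]; exact hcK _ _
  have hwH : ∀ t : Fin T, ∀ i ∈ H, w t i = target t (w (t + 1)) i := fun t i hi => by
    rw [hw t t.isLt, dif_pos t.isLt]; exact hc _ _ i hi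
  refine ⟨fun t i => w t i, fun i => w 0 i, fun r b t => ?_⟩
  rw [← observe_add_invisible (hwK t) (inputBits (I := I) σ f m r b t)]
  congr 2
  funext i
  rw [Pi.add_apply]
  simp only [inputBits]
  by_cases hM : i ∈ I \ E
  · rw [dif_pos hM, dif_pos hM, hwH t i (hIH (Finset.mem_sdiff.1 hM).1)]
    simp only [target]
    rw [dif_pos hM, add_sub_cancel]
  rw [dif_neg hM, dif_neg hM]
  by_cases hR : i ∈ E ∪ R
  · rw [dif_pos hR, dif_pos hR]; rfl
  rw [dif_neg hR, dif_neg hR]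
  have hE : i ∉ E := fun h => hR (Finset.mem_union_left _ h)
  by_cases hF : i ∈ F
  · rw [dif_pos hF, dif_pos hF, hwH t i (hFH hF)]
    simp only [target]
    rw [dif_neg hM, dif_neg hE, add_zero]
  rw [dif_neg hF, dif_neg hF]
  have hB : i ∈ B := by
    rcases hcover i with h | h | h | h
    · exact absurd (Finset.mem_sdiff.2 ⟨h, hE⟩) hM
    · exact absurd (Finset.mem_union_right _ h) hR
    · exact absurd h hF
    · exact h
  rw [dif_pos hB, dif_pos hB]
  by_cases ht : t.val = 0
  · rw [if_pos ht, if_pos ht, Pi.add_apply, ht]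
  -- The bit on `B` repeats the bit of block `t - 1` at `σ i`, whose shift was prescribed as `w t
  -- (σ.symm (σ i)) = w t i`.
  · rw [if_neg ht, if_neg ht, Pi.add_apply, Pi.add_apply]
    have hlt : t.val - 1 < T := by omega
    have hσ := (σ ⟨i, hB⟩).2
    have h := hwH ⟨t.val - 1, hlt⟩ _ (hIH (hEI hσ))
    have hn : ((σ ⟨i, hB⟩ : E) : Fin (2 ^ n)) ∉ I \ E := fun h' => (Finset.mem_sdiff.1 h').2 hσ
    simp only [target] at h
    rw [dif_neg hn, dif_pos hσ, Subtype.coe_eta, Equiv.symm_apply_apply,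
      Nat.sub_add_cancel (Nat.one_le_iff_ne_zero.2 ht)] at h
    simp only [h]

theorem map_uniformOfFintype_equiv {α : Type*} [Fintype α] [Nonempty α] (e : α ≃ α) :
    (PMF.uniformOfFintype α).map e = PMF.uniformOfFintype α := by
  ext b
  rw [PMF.map_apply, tsum_eq_single (e.symm b)]
  · simp
  · intro a ha
    rw [if_neg]
    rintro rfl
    simp at ha

theorem mutualInfo_bind_map {α γ : Type} [Fintype α] [Fintype γ] (p : PMF α) (q : PMF γ) :
    mutualInfo (p.bind fun a => q.map (Prod.mk a)) = 0 := by
  classical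
  have h1 : (p.bind fun a => q.map (Prod.mk a)).map Prod.fst = p := by
    rw [PMF.map_bind]
    have : ∀ a : α, (q.map (Prod.mk a)).map Prod.fst = PMF.pure a := fun a => by
      rw [PMF.map_comp]; exact PMF.map_const q a
    simp only [this, PMF.bind_pure]
  have h2 : (p.bind fun a => q.map (Prod.mk a)).map Prod.snd = q := by
    rw [PMF.map_bind]
    have : ∀ a : α, (q.map (Prod.mk a)).map Prod.snd = q := fun a => by
      rw [PMF.map_comp]; exact PMF.map_id q
    simp only [this, PMF.bind_const]
  have h3 : ∀ a c, (p.bind fun a => q.map (Prod.mk a)) (a, c) = p a * q c := by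
    intro a c
    rw [PMF.bind_apply, tsum_eq_single a]
    · congr 1
      rw [PMF.map_apply, tsum_eq_single c]
      · simp
      · intro c' hc'
        rw [if_neg]
        simpa using hc'.symm
    · intro a' ha'
      rw [PMF.map_apply]
      have : ∀ c', ¬ (a, c) = (a', c') := fun c' h => ha' (Prod.mk.inj h).1.symm
      simp [this]
  rw [mutualInfo, h1, h2]
  refine Finset.sum_eq_zero fun a _ => Finset.sum_eq_zero fun c _ => ?_
  rw [h3, ENNReal.toReal_mul]
  by_cases h : (p a).toReal * (q c).toReal = 0
  · simp [h]
  · rw [div_self h, Real.logb_one, mul_zero]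

/-- Translation by the compensating shift permutes the uniform random bits, so Eve's view under any
message has the law of the view under message 0, and the joint law is a product. -/
theorem leakage_eq_zero (σ : B ≃ E) (H : Finset (Fin (2 ^ n))) (hEI : E ⊆ I) (hIH : I ⊆ H)
    (hFH : F ⊆ H) (hcover : ∀ i, i ∈ I ∨ i ∈ R ∨ i ∈ F ∨ i ∈ B)
    (f : BlockBits T F) (pM : PMF (BlockBits T (I \ E))) (S : Fin T → Finset (Fin (2 ^ n)))
    (hS : ∀ t, ∀ i ∈ H, ∃ v ∈ invisible (S t), (∀ j < i, v j = 0) ∧ v i = 1) :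
    leakage (I := I) (R := R) σ f pM S = 0 := by
  let view (m : BlockBits T (I \ E)) (rb : BlockBits T (E ∪ R) × (B → ZMod 2)) :
      Fin T → Fin (2 ^ n) → Option (ZMod 2) := fun t =>
    observe (S t) (Matrix.vecMul (inputBits (I := I) σ f m rb.1 rb.2 t) (G n))
  let U : PMF (BlockBits T (E ∪ R) × (B → ZMod 2)) := PMF.uniformOfFintype _
  have hview : ∀ m, U.map (view m) = U.map (view 0) := by
    intro m
    obtain ⟨dr, db, hd⟩ := exists_shift (R := R) σ H hEI hIH hFH hcover f S hS 0 m
    have h : view m ∘ Equiv.addRight (dr, db) = view 0 := by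
      funext rb t
      exact hd rb.1 rb.2 t
    rw [← h, ← PMF.map_comp]
    simp only [U, map_uniformOfFintype_equiv]
  have hjoint : jointLaw (I := I) (R := R) σ f pM S =
      pM.bind fun m => (U.map (view 0)).map (Prod.mk m) := by
    rw [jointLaw]
    congr 1
    funext m
    rw [← hview m, PMF.map_comp]
    rfl
  rw [leakage, hjoint, mutualInfo_bind_map]

end Chaining

/-! ### Upper bound on the leakage -/

theorem sum_toReal_pmf {α : Type*} [Fintype α] (p : PMF α) : ∑ a, (p a).toReal = 1 := by
  rw [← ENNReal.toReal_sum fun a _ => p.apply_ne_top a, ← tsum_fintype (L := .unconditional _),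
    p.tsum_coe, ENNReal.toReal_one]

theorem toReal_pmf_map {α γ : Type*} [Fintype α] [DecidableEq γ] (p : PMF α) (g : α → γ) (c : γ) :
    ((p.map g) c).toReal = ∑ a, if g a = c then (p a).toReal else 0 := by
  rw [PMF.map_apply, tsum_fintype, ENNReal.toReal_sum]
  · refine Finset.sum_congr rfl fun a _ => ?_
    by_cases h : g a = c
    · rw [if_pos h, if_pos h.symm]
    · rw [if_neg h, if_neg (Ne.symm h), ENNReal.toReal_zero]
  · intro a _
    split_ifs
    · exact p.apply_ne_top a
    · exact ENNReal.zero_ne_top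

/-- This controls the expected leakage on the bad event. Since `J ≤ Q`, the ratio is at most `1 / P
= C * (1 / (P * C))`; then `log x ≤ x - 1` at `x = 1 / (P * C)` leaves an error whose sum is
nonpositive. -/
theorem mutualInfo_le_logb_card {α γ : Type} [Fintype α] [Fintype γ] (q : PMF (α × γ)) :
    mutualInfo q ≤ Real.logb 2 (Fintype.card α) := by
  classical
  set P : α → ℝ := fun a => ((q.map Prod.fst) a).toReal with hP
  set Q : γ → ℝ := fun c => ((q.map Prod.snd) c).toReal with hQ
  set J : α × γ → ℝ := fun x => (q x).toReal with hJ
  have hJ0 : ∀ x, 0 ≤ J x := fun x => ENNReal.toReal_nonneg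
  have hPsum : ∀ a, P a = ∑ c, J (a, c) := by
    intro a
    simp only [hP]
    rw [toReal_pmf_map, Fintype.sum_prod_type, Finset.sum_eq_single a]
    · simp [hJ]
    · intro a' _ h; simp [h]
    · simp
  have hQsum : ∀ c, Q c = ∑ a, J (a, c) := by
    intro c
    simp only [hQ]
    rw [toReal_pmf_map, Fintype.sum_prod_type_right, Finset.sum_eq_single c]
    · simp [hJ]
    · intro a' _ h; simp [h]
    · simp
  have hJP : ∀ a c, J (a, c) ≤ P a := fun a c => by
    rw [hPsum]
    exact Finset.single_le_sum (f := fun c => J (a, c)) (fun c _ => hJ0 _) (Finset.mem_univ c)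
  have hJQ : ∀ a c, J (a, c) ≤ Q c := fun a c => by
    rw [hQsum]
    exact Finset.single_le_sum (f := fun a => J (a, c)) (fun c _ => hJ0 _) (Finset.mem_univ a)
  have hne : Nonempty α := by
    obtain ⟨x, -⟩ := q.support_nonempty
    exact ⟨x.1⟩
  have hcard : (0 : ℝ) < Fintype.card α := Nat.cast_pos.2 Fintype.card_pos
  have hlog2 : 0 < Real.log 2 := Real.log_pos one_lt_two
  set C : ℝ := (Fintype.card α : ℝ) with hC
  -- each term is at most the tangent bound of the logarithm
  have hterm : ∀ a c, J (a, c) * Real.logb 2 (J (a, c) / (P a * Q c)) ≤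
      J (a, c) * Real.logb 2 C + (J (a, c) / (P a * C) - J (a, c)) / Real.log 2 := by
    intro a c
    rcases (hJ0 (a, c)).eq_or_lt with h | h
    · simp [← h]
    have hPp := h.trans_le (hJP a c)
    have hQp := h.trans_le (hJQ a c)
    have h1 : Real.log (J (a, c) / (P a * Q c)) ≤ Real.log C + (1 / (P a * C) - 1) := by
      have h2 : J (a, c) / (P a * Q c) ≤ C * (1 / (P a * C)) := by
        rw [show C * (1 / (P a * C)) = 1 / P a by field_simp, div_le_div_iff₀ (by positivity) hPp]
        nlinarith [hJQ a c]
      calc Real.log (J (a, c) / (P a * Q c)) ≤ Real.log (C * (1 / (P a * C))) :=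
            Real.log_le_log (by positivity) h2
        _ = Real.log C + Real.log (1 / (P a * C)) :=
            Real.log_mul (by positivity) (by positivity)
        _ ≤ _ := by gcongr; exact Real.log_le_sub_one_of_pos (by positivity)
    have h3 : J (a, c) * Real.logb 2 C + (J (a, c) / (P a * C) - J (a, c)) / Real.log 2 =
        J (a, c) * ((Real.log C + (1 / (P a * C) - 1)) / Real.log 2) := by
      rw [Real.logb]; ring
    rw [h3, Real.logb]
    gcongr
  have hsum : ∑ a, ∑ c, J (a, c) = 1 := by
    rw [← Fintype.sum_prod_type]; exact sum_toReal_pmf q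
  have hdiv : ∑ a, ∑ c, J (a, c) / (P a * C) ≤ 1 := by
    calc ∑ a, ∑ c, J (a, c) / (P a * C) = ∑ a, P a / (P a * C) := by
          simp only [← Finset.sum_div, ← hPsum]
      _ ≤ ∑ _a : α, 1 / C := by
          refine Finset.sum_le_sum fun a _ => ?_
          -- Outside the support of `P` the quotient is 0 by convention, hence only an inequality.
          by_cases h : P a = 0
          · rw [h, zero_div]; positivity
          · rw [div_mul_eq_div_div, div_self h]
      _ = 1 := by
          rw [Finset.sum_const, Finset.card_univ, nsmul_eq_mul]
          exact mul_one_div_cancel hcard.ne'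
  calc mutualInfo q = ∑ a, ∑ c, J (a, c) * Real.logb 2 (J (a, c) / (P a * Q c)) := rfl
    _ ≤ ∑ a, ∑ c, (J (a, c) * Real.logb 2 C +
          (J (a, c) / (P a * C) - J (a, c)) / Real.log 2) :=
        Finset.sum_le_sum fun a _ => Finset.sum_le_sum fun c _ => hterm a c
    _ = (∑ a, ∑ c, J (a, c)) * Real.logb 2 C +
          (∑ a, ∑ c, J (a, c) / (P a * C) - ∑ a, ∑ c, J (a, c)) / Real.log 2 := by
        simp only [Finset.sum_add_distrib, Finset.sum_mul, ← Finset.sum_div,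
          Finset.sum_sub_distrib]
    _ ≤ Real.logb 2 C := by
        rw [hsum, one_mul]
        have : (∑ a, ∑ c, J (a, c) / (P a * C) - 1) / Real.log 2 ≤ 0 :=
          div_nonpos_of_nonpos_of_nonneg (by linarith) hlog2.le
        linarith

theorem leakage_le {n T : ℕ} {I R F B E : Finset (Fin (2 ^ n))} (σ : B ≃ E)
    (f : BlockBits T F) (pM : PMF (BlockBits T (I \ E))) (S : Fin T → Finset (Fin (2 ^ n))) :
    leakage (I := I) (R := R) σ f pM S ≤ T * 2 ^ n := by
  refine (mutualInfo_le_logb_card _).trans ?_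
  have h : Fintype.card (BlockBits T (I \ E)) = 2 ^ ((I \ E).card * T) := by
    rw [Fintype.card_fun, Fintype.card_fun, ZMod.card, Fintype.card_coe, Fintype.card_fin, pow_mul]
  rw [h, Nat.cast_pow, Nat.cast_two, Real.logb_pow, Real.logb_self_eq_one one_lt_two, mul_one,
    Nat.cast_mul, mul_comm]
  gcongr
  have := Finset.card_le_univ (I \ E)
  rw [Fintype.card_fin] at this
  exact_mod_cast this

end AWTC

namespace AWTC

open Filter Topology

/-! ### Total mass of the two laws -/

theorem fixedLaw_nonneg (n k : ℕ) (S : Finset (Fin (2 ^ n))) : 0 ≤ fixedLaw n k S := by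
  rw [fixedLaw]; split_ifs <;> positivity

theorem indepLaw_nonneg (n : ℕ) {p : ℝ} (h0 : 0 ≤ p) (h1 : p ≤ 1) (S : Finset (Fin (2 ^ n))) :
    0 ≤ indepLaw n p S :=
  mul_nonneg (pow_nonneg h0 _) (pow_nonneg (sub_nonneg.2 h1) _)

theorem sum_fixedLaw_le (n k : ℕ) : ∑ S, fixedLaw n k S ≤ 1 := by
  simp only [fixedLaw]
  rw [← Finset.sum_filter, Finset.sum_const, nsmul_eq_mul]
  have h : (Finset.univ.filter fun S : Finset (Fin (2 ^ n)) => S.card = k).card =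
      (2 ^ n).choose k := by
    rw [Finset.univ_filter_card_eq, Finset.card_powersetCard, Finset.card_univ, Fintype.card_fin]
  rw [h]
  rw [mul_one_div]
  exact div_self_le_one _

theorem sum_indepLaw (n : ℕ) (p : ℝ) : ∑ S, indepLaw n p S = 1 := by
  have h := Finset.sum_pow_mul_eq_add_pow p (1 - p) (Finset.univ : Finset (Fin (2 ^ n)))
  rw [Finset.powerset_univ, Finset.card_univ, Fintype.card_fin, add_sub_cancel, one_pow] at h
  exact h

/-! ### Comparison of the fixed-fraction law with the independent law -/

/-- The binomial probability of any value is at most a linear factor times that of a value next to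
the mean. -/
theorem binomial_le (N k : ℕ) (hkN : k ≤ N) {p : ℝ} (h0 : 0 < p) (h1 : p < 1)
    (hk : |(k : ℝ) - p * N| < 1) (j : ℕ) (hj : j ≤ N) :
    (N.choose j : ℝ) * p ^ j * (1 - p) ^ (N - j) ≤
      (1 + p / (1 - p) + (1 - p) / p) * (N + 1) *
        ((N.choose k : ℝ) * p ^ k * (1 - p) ^ (N - k)) := by
  have hq : 0 < 1 - p := sub_pos.2 h1
  obtain ⟨hk1, hk2⟩ := abs_lt.1 hk
  set P : ℕ → ℝ := fun j => (N.choose j : ℝ) * p ^ j * (1 - p) ^ (N - j) with hP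
  have hP0 : ∀ j, 0 ≤ P j := fun j => by positivity
  -- Beyond the neighbours of `k` the probabilities decrease away from the mean. The steps from `k`
  -- to `k + 1` and `k - 1` need not decrease, and cost at most `p / (1 - p) * N` and `(1 - p) / p *
  -- N`; the summand 1 covers `j = k`.
  set C : ℝ := (1 + p / (1 - p) + (1 - p) / p) * (N + 1) with hC
  have hstep : ∀ j < N, P (j + 1) * ((j + 1) * (1 - p)) = P j * ((N - j) * p) := by
    intro j hj
    have e : ((N.choose (j + 1) : ℕ) : ℝ) * (j + 1) = (N.choose j : ℝ) * (N - j) := by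
      have := Nat.choose_succ_right_eq N j
      rw [← Nat.cast_sub hj.le]
      exact_mod_cast this
    have e2 : N - j = (N - (j + 1)) + 1 := by omega
    simp only [hP]
    rw [e2, pow_succ, pow_succ]
    linear_combination p ^ j * p * (1 - p) ^ (N - (j + 1)) * (1 - p) * e
  have hup : ∀ j, k < j → j < N → P (j + 1) ≤ P j := by
    intro j hkj hj
    have hkj' : (k : ℝ) + 1 ≤ j := by exact_mod_cast hkj
    have hpos : 0 < ((j : ℝ) + 1) * (1 - p) := by positivity
    refine le_of_mul_le_mul_right ?_ hpos
    rw [hstep j hj]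
    exact mul_le_mul_of_nonneg_left (by nlinarith) (hP0 j)
  have hdown : ∀ j, j + 1 < k → P j ≤ P (j + 1) := by
    intro j hjk
    have hjk' : (j : ℝ) + 1 + 1 ≤ k := by exact_mod_cast hjk
    have hjN : (j : ℝ) + 1 + 1 ≤ N := by exact_mod_cast hjk.trans_le hkN
    have hpos : 0 < ((N : ℝ) - j) * p := mul_pos (by linarith) h0
    refine le_of_mul_le_mul_right ?_ hpos
    rw [← hstep j (by omega)]
    exact mul_le_mul_of_nonneg_left (by nlinarith) (hP0 _)
  have hN0 : (0 : ℝ) ≤ N := Nat.cast_nonneg N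
  have hr1 : 0 < p / (1 - p) := by positivity
  have hr2 : 0 < (1 - p) / p := by positivity
  have hC1 : 1 ≤ C := by
    rw [hC]; nlinarith [mul_nonneg hr1.le hN0, mul_nonneg hr2.le hN0]
  have hCp : p / (1 - p) * N ≤ C := by
    rw [hC]; nlinarith [mul_nonneg hr2.le hN0]
  have hCq : (1 - p) / p * N ≤ C := by
    rw [hC]; nlinarith [mul_nonneg hr1.le hN0]
  change P j ≤ C * P k
  have hself : P k ≤ C * P k := le_mul_of_one_le_left (hP0 k) hC1
  rcases lt_trichotomy j k with h | rfl | h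
  · have hbase : P (k - 1) ≤ C * P k := by
      obtain ⟨l, rfl⟩ : ∃ l, k = l + 1 := ⟨k - 1, by omega⟩
      rw [Nat.add_sub_cancel]
      refine le_trans ?_ (mul_le_mul_of_nonneg_right hCq (hP0 _))
      have hl : (l : ℝ) + 1 ≤ N := by exact_mod_cast hkN
      have e := hstep l (by omega)
      have e3 : P l * p ≤ P l * ((N - l) * p) :=
        mul_le_mul_of_nonneg_left (by nlinarith) (hP0 l)
      have e4 : P (l + 1) * ((l + 1) * (1 - p)) ≤ P (l + 1) * (N * (1 - p)) :=
        mul_le_mul_of_nonneg_left (mul_le_mul_of_nonneg_right hl hq.le) (hP0 _)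
      rw [div_mul_eq_mul_div, div_mul_eq_mul_div, le_div_iff₀ h0]
      linarith
    have hmono : ∀ i, i + 1 ≤ k → P (k - 1 - i) ≤ P (k - 1) := by
      intro i
      induction i with
      | zero => intro _; rfl
      | succ i ih =>
        intro hi
        refine le_trans ?_ (ih (by omega))
        have := hdown (k - 1 - (i + 1)) (by omega)
        rwa [show k - 1 - (i + 1) + 1 = k - 1 - i by omega] at this
    have := hmono (k - 1 - j) (by omega)
    rw [show k - 1 - (k - 1 - j) = j by omega] at this
    exact this.trans hbase
  · exact hself
  · have hbase : P (k + 1) ≤ C * P k := by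
      refine le_trans ?_ (mul_le_mul_of_nonneg_right hCp (hP0 _))
      have e := hstep k (by omega)
      have hk0 : (0 : ℝ) ≤ k := Nat.cast_nonneg k
      have e3 : P (k + 1) * (1 - p) ≤ P (k + 1) * ((k + 1) * (1 - p)) :=
        mul_le_mul_of_nonneg_left (by nlinarith) (hP0 _)
      have e4 : P k * ((N - k) * p) ≤ P k * (N * p) :=
        mul_le_mul_of_nonneg_left (by nlinarith) (hP0 _)
      rw [div_mul_eq_mul_div, div_mul_eq_mul_div, le_div_iff₀ hq]
      linarith
    have hmono : ∀ i, k + 1 + i ≤ N → P (k + 1 + i) ≤ P (k + 1) := by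
      intro i
      induction i with
      | zero => intro _; rfl
      | succ i ih => exact fun hi => (hup (k + 1 + i) (by omega) (by omega)).trans (ih (by omega))
    have := hmono (j - (k + 1)) (by omega)
    rw [show k + 1 + (j - (k + 1)) = j by omega] at this
    exact this.trans hbase

/-- The `N + 1` binomial probabilities sum to 1 and each obeys `binomial_le`, whence the second
factor `N + 1`. -/
theorem one_le_binomial (N k : ℕ) (hkN : k ≤ N) {p : ℝ} (h0 : 0 < p) (h1 : p < 1)
    (hk : |(k : ℝ) - p * N| < 1) :
    1 ≤ (1 + p / (1 - p) + (1 - p) / p) * (N + 1) ^ 2 *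
        ((N.choose k : ℝ) * p ^ k * (1 - p) ^ (N - k)) := by
  have h := add_pow p (1 - p) N
  rw [add_sub_cancel, one_pow] at h
  refine h.trans_le ((Finset.sum_le_card_nsmul _ _
    ((1 + p / (1 - p) + (1 - p) / p) * (N + 1) *
      ((N.choose k : ℝ) * p ^ k * (1 - p) ^ (N - k))) fun j hj => ?_).trans_eq ?_)
  · have := binomial_le N k hkN h0 h1 hk j (Nat.lt_succ_iff.1 (Finset.mem_range.1 hj))
    linarith
  · rw [Finset.card_range, nsmul_eq_mul]
    push_cast
    ring

/-- Conditioned on its size being `k`, the independent set is uniform, so the ratio of the laws is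
the inverse of a binomial probability next to the mean. -/
theorem fixedLaw_le_indepLaw (n k : ℕ) {p : ℝ} (h0 : 0 ≤ p) (h1 : p < 1)
    (hk : |(k : ℝ) - p * 2 ^ n| < 1) (S : Finset (Fin (2 ^ n))) :
    fixedLaw n k S ≤
      (1 + p / (1 - p) + (1 - p) / p) * ((2 : ℝ) ^ n + 1) ^ 2 * indepLaw n p S := by
  have hq : 0 < 1 - p := sub_pos.2 h1
  have hC : 0 ≤ 1 + p / (1 - p) + (1 - p) / p := by positivity
  rw [fixedLaw]
  split_ifs with hS
  · have hkN : k ≤ 2 ^ n := by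
      rw [← hS]
      simpa using Finset.card_le_univ S
    -- For `p = 0` the quotient by `p` is 0 by convention, so the constant is 1, and `k = 0`.
    rcases h0.eq_or_lt with rfl | hp
    · have : k = 0 := by
        rw [zero_mul, sub_zero, Nat.abs_cast] at hk
        exact Nat.lt_one_iff.1 (by exact_mod_cast hk)
      subst this
      have h2 : (1 : ℝ) ≤ ((2 : ℝ) ^ n + 1) ^ 2 := 
        one_le_pow₀ (le_add_of_nonneg_left (by positivity))
      simpa [indepLaw, hS] using h2
    · have h := one_le_binomial (2 ^ n) k hkN hp h1 (by push_cast; exact hk)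
      have hch : (0 : ℝ) < (2 ^ n).choose k := Nat.cast_pos.2 (Nat.choose_pos hkN)
      rw [div_le_iff₀ hch, indepLaw, hS]
      push_cast at h
      linarith
  · have := indepLaw_nonneg n h0 h1.le S
    positivity

/-! ### Security from a comparison of the attack law with the design law -/

theorem sum_ite_comp_eq {α γ : Type*} [Fintype α] [Fintype γ] [DecidableEq γ] (μ : PMF α)
    (g : α → γ) (q : γ → Prop) [DecidablePred q] :
    ∑ a, (if q (g a) then (μ a).toReal else 0) =
      ∑ c, if q c then ((μ.map g) c).toReal else 0 := by
  simp only [toReal_pmf_map, ← Finset.sum_filter]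
  rw [Finset.sum_comm' (t' := Finset.univ.filter fun a => q (g a)) (s' := fun a => {g a})]
  · simp
  · intro c a
    simp
    constructor
    · rintro ⟨h, rfl⟩; exact ⟨rfl, h⟩
    · rintro ⟨rfl, h⟩; exact ⟨h, rfl⟩

theorem prob_polarized_not_noisy_le {n : ℕ} {β κ : ℝ} {law attack : Finset (Fin (2 ^ n)) → ℝ}
    (hκ : 0 ≤ κ) (hsum : ∑ A, law A ≤ 1) (hle : ∀ A, attack A ≤ κ * law A) {i : Fin (2 ^ n)}
    (hi : i ∈ setHr β law) :
    ∑ A, (if (polarize n (readBlock A) i).Z ≠ 1 then attack A else 0) ≤ κ * delta β n := by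
  classical
  have hi' : 1 - delta β n ≤ probZOne law readBlock i := (Finset.mem_filter.1 hi).2
  have hsplit : ∑ A, (if (polarize n (readBlock A) i).Z ≠ 1 then law A else 0) +
      probZOne law readBlock i = ∑ A, law A := by
    rw [probZOne, ← Finset.sum_add_distrib]
    refine Finset.sum_congr rfl fun A _ => ?_
    by_cases h : (polarize n (readBlock A) i).Z = 1 <;> simp [h]
  calc _ ≤ ∑ A, κ * (if (polarize n (readBlock A) i).Z ≠ 1 then law A else 0) := by
        refine Finset.sum_le_sum fun A _ => ?_
        split_ifs
        · exact hle A
        · simp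
    _ = κ * ∑ A, (if (polarize n (readBlock A) i).Z ≠ 1 then law A else 0) :=
        (Finset.mul_sum _ _ _).symm
    _ ≤ κ * delta β n := mul_le_mul_of_nonneg_left (by linarith) hκ

/-- Union bound over blocks and positions in `H_r`; outside the bad event the leakage is 0, and on
it at most `T * 2 ^ n`. -/
theorem leakage_bounds {n T : ℕ} {β κ : ℝ} {lawW lawR attack : Finset (Fin (2 ^ n)) → ℝ}
    (hκ : 0 ≤ κ) (hsum : ∑ A, lawR A ≤ 1) (hle : ∀ A, attack A ≤ κ * lawR A)
    {E : Finset (Fin (2 ^ n))} (hE : E ⊆ setI β lawW lawR) (σ : setB β lawW lawR ≃ E)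
    (f : BlockBits T (setF β lawW lawR)) (pM : PMF (BlockBits T (setI β lawW lawR \ E)))
    (μ : PMF (Fin T → Finset (Fin (2 ^ n))))
    (hμ : ∀ t A, ((μ.map fun S => S t) A).toReal = attack A) :
    1 - T * 2 ^ n * (κ * delta β n) ≤
        (μ.toOuterMeasure {S | leakage (R := setR β lawW lawR) σ f pM S = 0}).toReal ∧
      ∑ S, (μ S).toReal * leakage (R := setR β lawW lawR) σ f pM S ≤
        (T * 2 ^ n) ^ 2 * (κ * delta β n) := by
  classical
  set L := fun S => leakage (R := setR β lawW lawR) σ f pM S with hL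
  set w : (Fin T → Finset (Fin (2 ^ n))) → ℝ := fun S => (μ S).toReal with hw
  have hw0 : ∀ S, 0 ≤ w S := fun S => ENNReal.toReal_nonneg
  set H := setHr β lawR with hH
  let bad : (Fin T → Finset (Fin (2 ^ n))) → Prop := fun S =>
    ∃ t, ∃ i ∈ H, (polarize n (readBlock (S t)) i).Z ≠ 1
  have hgood : ∀ S, ¬ bad S → L S = 0 := by
    intro S hS
    refine leakage_eq_zero σ H hE Finset.inter_subset_right Finset.inter_subset_right
      (fun i => ?_) f pM S fun t i hi => ?_
    · simp only [setI, setR, setB, Finset.mem_inter, Finset.mem_compl]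
      tauto
    · have : (polarize n (readBlock (S t)) i).Z = 1 := by
        by_contra h
        exact hS ⟨t, i, hi, h⟩
      obtain ⟨v, h0, h1, h2⟩ := exists_leading_vector_of_Z_eq_one this
      exact ⟨v, h2, h0, h1⟩
  have hbad : ∑ S, (if bad S then w S else 0) ≤ T * 2 ^ n * (κ * delta β n) := by
    have hδ : 0 ≤ κ * delta β n := mul_nonneg hκ (Real.rpow_nonneg zero_le_two _)
    calc ∑ S, (if bad S then w S else 0)
        ≤ ∑ S, ∑ t, ∑ i ∈ H, (if (polarize n (readBlock (S t)) i).Z ≠ 1 then w S else 0) := by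
          refine Finset.sum_le_sum fun S _ => ?_
          have hnn : ∀ (t : Fin T) (i : Fin (2 ^ n)),
              0 ≤ (if (polarize n (readBlock (S t)) i).Z ≠ 1 then w S else 0) := fun t i => by
            split_ifs
            · exact hw0 S
            · exact le_rfl
          split_ifs with hS
          · obtain ⟨t, i, hi, h⟩ := hS
            calc w S = if (polarize n (readBlock (S t)) i).Z ≠ 1 then w S else 0 :=
                  (if_pos h).symm
              _ ≤ ∑ i ∈ H, if (polarize n (readBlock (S t)) i).Z ≠ 1 then w S else 0 :=
                  Finset.single_le_sum (f := fun i =>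
                    if (polarize n (readBlock (S t)) i).Z ≠ 1 then w S else 0)
                    (fun i _ => hnn t i) hi
              _ ≤ _ := Finset.single_le_sum (f := fun t => ∑ i ∈ H,
                    if (polarize n (readBlock (S t)) i).Z ≠ 1 then w S else 0)
                    (fun t _ => Finset.sum_nonneg fun i _ => hnn t i) (Finset.mem_univ t)
          · exact Finset.sum_nonneg fun t _ => Finset.sum_nonneg fun i _ => hnn t i
      _ = ∑ t, ∑ i ∈ H, ∑ S,
            (if (polarize n (readBlock (S t)) i).Z ≠ 1 then w S else 0) := by
          rw [Finset.sum_comm]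
          exact Finset.sum_congr rfl fun t _ => Finset.sum_comm
      _ ≤ ∑ _t : Fin T, ∑ _i ∈ H, κ * delta β n := by
          refine Finset.sum_le_sum fun t _ => Finset.sum_le_sum fun i hi => ?_
          -- Each event concerns a single block, so only the marginal law enters and the dependence
          -- between blocks is irrelevant.
          rw [sum_ite_comp_eq μ (fun S => S t)
            fun A => (polarize n (readBlock A) i).Z ≠ 1]
          simp only [hμ]
          exact prob_polarized_not_noisy_le hκ hsum hle hi
      _ = T * (H.card * (κ * delta β n)) := by simp
      _ ≤ T * (2 ^ n * (κ * delta β n)) := by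
          gcongr
          have := Finset.card_le_univ H
          rw [Fintype.card_fin] at this
          exact_mod_cast this
      _ = _ := by ring
  constructor
  · have hprob : (μ.toOuterMeasure {S | L S = 0}).toReal = ∑ S, if L S = 0 then w S else 0 := by
      rw [PMF.toOuterMeasure_apply_fintype, ENNReal.toReal_sum]
      · refine Finset.sum_congr rfl fun S _ => ?_
        by_cases h : L S = 0 <;> simp [Set.indicator, h, hw]
      · intro S _
        exact ne_top_of_le_ne_top (μ.apply_ne_top S) (Set.indicator_le_self _ _ S)
    have hsplit : (1 : ℝ) ≤
        ∑ S, (if L S = 0 then w S else 0) + ∑ S, (if bad S then w S else 0) := by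
      refine (sum_toReal_pmf μ).ge.trans ?_
      rw [← Finset.sum_add_distrib]
      refine Finset.sum_le_sum fun S _ => ?_
      by_cases hS : bad S
      · rw [if_pos hS]
        have : 0 ≤ if L S = 0 then w S else 0 := by
          split_ifs
          · exact hw0 S
          · exact le_rfl
        linarith
      · rw [if_neg hS, if_pos (hgood S hS), add_zero]
    rw [hprob]
    linarith
  · calc ∑ S, w S * L S ≤ ∑ S, T * 2 ^ n * (if bad S then w S else 0) := by
          refine Finset.sum_le_sum fun S _ => ?_
          split_ifs with hS
          · rw [mul_comm]
            exact mul_le_mul_of_nonneg_right (leakage_le σ f pM S) (hw0 S)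
          · rw [hgood S hS, mul_zero, mul_zero]
      _ = T * 2 ^ n * ∑ S, (if bad S then w S else 0) := (Finset.mul_sum _ _ _).symm
      _ ≤ T * 2 ^ n * (T * 2 ^ n * (κ * delta β n)) :=
          mul_le_mul_of_nonneg_left hbad (by positivity)
      _ = _ := by ring

/-! ### Asymptotics and conclusion -/

theorem tendsto_pow_mul_delta {β : ℝ} (hβ : 0 < β) (s : ℕ) :
    Tendsto (fun n : ℕ => ((2 : ℝ) ^ n) ^ s * delta β n) atTop (𝓝 0) := by
  have hx : Tendsto (fun n : ℕ => ((2 : ℝ) ^ n) ^ β) atTop atTop :=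
    (tendsto_rpow_atTop hβ).comp (tendsto_pow_atTop_atTop_of_one_lt one_lt_two)
  -- With `x = N ^ β` the expression is `x ^ (s / β) * exp (-(log 2) * x)`.
  have h := (tendsto_rpow_mul_exp_neg_mul_atTop_nhds_zero (s / β) (Real.log 2)
    (Real.log_pos one_lt_two)).comp hx
  refine h.congr fun n => ?_
  have hN : (0 : ℝ) ≤ 2 ^ n := by positivity
  simp only [Function.comp_apply]
  rw [← Real.rpow_mul hN, mul_div_cancel₀ _ hβ.ne', Real.rpow_natCast, delta,
    Real.rpow_def_of_pos two_pos]
  congr 2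
  ring

theorem stronglySecure_of_le {β : ℝ} (hβ : 0 < β) (T : ℕ)
    {designW designR attack : (n : ℕ) → Finset (Fin (2 ^ n)) → ℝ} (C : ℝ) (hC : 0 ≤ C)
    (hsum : ∀ n, ∑ A, designR n A ≤ 1)
    (hle : ∀ n A, attack n A ≤ C * ((2 : ℝ) ^ n + 1) ^ 2 * designR n A) :
    StronglySecure β T designW designR attack := by
  intro ε hε
  -- From `(N + 1) ^ 2 ≤ 4 * N ^ 2`, the bounds with prefactors `T N` and `(T N) ^ 2` are both at
  -- most this multiple of `N ^ 4 * δ_N`.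
  have hlim : Tendsto (fun n : ℕ => (4 * (T + T ^ 2) * C) * (((2 : ℝ) ^ n) ^ 4 * delta β n))
      atTop (𝓝 0) := by
    simpa using (tendsto_pow_mul_delta hβ 4).const_mul (4 * ((T : ℝ) + T ^ 2) * C)
  obtain ⟨n₀, hn₀⟩ := eventually_atTop.1 (hlim.eventually (ge_mem_nhds hε))
  refine ⟨n₀, fun n hn E hE σ f pM μ hμ => ?_⟩
  have hb := leakage_bounds (κ := C * ((2 : ℝ) ^ n + 1) ^ 2) (by positivity) (hsum n) (hle n)
    hE σ f pM μ hμ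
  have hδ : 0 ≤ delta β n := Real.rpow_nonneg zero_le_two _
  have hN : (1 : ℝ) ≤ 2 ^ n := one_le_pow₀ one_le_two
  have hn' := hn₀ n hn
  set N : ℝ := 2 ^ n
  set δ := delta β n
  have hκ : C * (N + 1) ^ 2 * δ ≤ 4 * C * N ^ 2 * δ := by
    have : (N + 1) ^ 2 ≤ 4 * N ^ 2 := by nlinarith
    calc C * (N + 1) ^ 2 * δ ≤ C * (4 * N ^ 2) * δ := by gcongr
      _ = _ := by ring
  have h1 : T * N * (C * (N + 1) ^ 2 * δ) ≤ 4 * T * C * (N ^ 4 * δ) := by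
    calc T * N * (C * (N + 1) ^ 2 * δ) ≤ T * N ^ 2 * (4 * C * N ^ 2 * δ) := by
          gcongr
          exact le_self_pow₀ hN two_ne_zero
      _ = _ := by ring
  have h2 : (T * N) ^ 2 * (C * (N + 1) ^ 2 * δ) ≤ 4 * T ^ 2 * C * (N ^ 4 * δ) := by
    calc (T * N) ^ 2 * (C * (N + 1) ^ 2 * δ) ≤ (T * N) ^ 2 * (4 * C * N ^ 2 * δ) := by
          gcongr
      _ = _ := by ring
  have h3 : 0 ≤ 4 * T * C * (N ^ 4 * δ) := by positivity
  have h4 : 0 ≤ 4 * T ^ 2 * C * (N ^ 4 * δ) := by positivity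
  have h5 : 4 * (T + T ^ 2) * C * (N ^ 4 * δ) =
      4 * T * C * (N ^ 4 * δ) + 4 * T ^ 2 * C * (N ^ 4 * δ) := by ring
  exact ⟨by linarith [hb.1], by linarith [hb.2]⟩

theorem le_mul_sq_of_nonneg {x : ℝ} (hx : 0 ≤ x) (n : ℕ) :
    x ≤ 1 * ((2 : ℝ) ^ n + 1) ^ 2 * x := by
  have h2 : (1 : ℝ) ≤ 1 * ((2 : ℝ) ^ n + 1) ^ 2 := by
    rw [one_mul]
    exact one_le_pow₀ (le_add_of_nonneg_left (by positivity))
  exact le_mul_of_one_le_left hx h2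

end AWTC

theorem proposition3 (ρr ρw β : ℝ) (hρr : 0 ≤ ρr) (hρw : 0 ≤ ρw) (hρ : ρw + ρr < 1)
    (hβ : 0 < β) (hβ' : β < 1 / 2) (T : ℕ) (kr kw : ℕ → ℕ)
    (hkr : ∀ n, |(kr n : ℝ) - ρr * 2 ^ n| < 1) (hkw : ∀ n, |(kw n : ℝ) - ρw * 2 ^ n| < 1) :
    AWTC.StronglySecure β T (fun n => AWTC.fixedLaw n (kw n)) (fun n => AWTC.fixedLaw n (kr n))
        (fun n => AWTC.fixedLaw n (kr n)) ∧
      AWTC.StronglySecure β T (fun n => AWTC.indepLaw n ρw) (fun n => AWTC.indepLaw n ρr)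
        (fun n => AWTC.fixedLaw n (kr n)) ∧
      AWTC.StronglySecure β T (fun n => AWTC.indepLaw n ρw) (fun n => AWTC.indepLaw n ρr)
        (fun n => AWTC.indepLaw n ρr) := by
  have h1 : ρr < 1 := by linarith
  -- In the first and third cases attack and design laws agree, so `C = 1` suffices; the mixed case
  -- takes the binomial constant.
  refine ⟨AWTC.stronglySecure_of_le hβ T 1 zero_le_one (fun n => AWTC.sum_fixedLaw_le n _)
      fun n A => AWTC.le_mul_sq_of_nonneg (AWTC.fixedLaw_nonneg n _ A) n,
    AWTC.stronglySecure_of_le hβ T (1 + ρr / (1 - ρr) + (1 - ρr) / ρr) ?_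
      (fun n => (AWTC.sum_indepLaw n ρr).le)
      fun n A => AWTC.fixedLaw_le_indepLaw n (kr n) hρr h1 (hkr n) A,
    AWTC.stronglySecure_of_le hβ T 1 zero_le_one (fun n => (AWTC.sum_indepLaw n ρr).le)
      fun n A => AWTC.le_mul_sq_of_nonneg (AWTC.indepLaw_nonneg n hρr h1.le A) n⟩
  have hq : 0 < 1 - ρr := sub_pos.2 h1
  positivity
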